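/- Let $k,n\ge 1$ be integers, let $p=(p_1,\dots,p_k)$ be any probability distribution on $[k]=\{1,\dots,k\}$, and let $X_1,\dots,X_n$ be i.i.d. samples from $p$. Let $N_i=|\{j: X_j=i\}|$, let $\hat p^1$ be the Laplace (add-1) estimator, $\hat p^1_i=\frac{N_i+1}{n+k}$ for $i\in[k]$, and let $\mathrm{KL}(p\,\|\,q)=\sum_{i=1}^k p_i\log\frac{p_i}{q_i}$, where $\log$ is the natural logarithm and $0\log 0=0$. Then for every $\delta\in(0,1]$, with probability at least $1-\delta$, $$\mathrm{KL}(p\,\|\,\hat p^1)\le \mathbb E\big[\mathrm{KL}(p\,\|\,\hat p^1)\big]+\frac{6\sqrt{k\log^5(4k/\delta)}}{n}+\frac{311}{n}+\frac{160\,k}{n^{3/2}}.$$ In particular, there is a universal constant $C>0$ such that, for all $n\ge k\ge 1$, every such $p$ and every $\delta\in(0,1]$, with probability at least $1-\delta$, $$\mathrm{KL}(p\,\|\,\hat p^1)\le \mathbb E\big[\mathrm{KL}(p\,\|\,\hat p^1)\big]+C\,\frac{\sqrt k}{n}\,\log^{5/2}\!\Big(\frac{k}{\delta}\Big).$$ 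-/

import Mathlib

open MeasureTheory ProbabilityTheory

/-- The number of occurrences of the symbol `i` in the sequence `x` of length `n`. -/
def symbolCount {n k : ℕ} (x : Fin n → Fin k) (i : Fin k) : ℕ :=
  (Finset.univ.filter fun j => x j = i).card

/-- The add-`t` estimator of a distribution on `k` symbols from a sample `x` of length `n`:
symbol `i`, occurring `N_i` times, gets the mass `(N_i + t) / (n + k t)`. -/
noncomputable def addConstEstimator {n k : ℕ} (t : ℝ) (x : Fin n → Fin k) (i : Fin k) : ℝ :=
  ((symbolCount x i : ℝ) + t) / ((n : ℝ) + (k : ℝ) * t)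

/-- The Laplace estimator is the add-`1` estimator. -/
noncomputable def laplaceEstimator {n k : ℕ} (x : Fin n → Fin k) : Fin k → ℝ :=
  addConstEstimator 1 x

/-- Every mass assigned by the Laplace estimator is positive. -/
theorem laplaceEstimator_pos {n k : ℕ} (x : Fin n → Fin k) (i : Fin k) :
    0 < laplaceEstimator x i := by
  have hk : (0 : ℝ) < k := by exact_mod_cast i.pos
  unfold laplaceEstimator addConstEstimator
  positivity

/-- The Kullback-Leibler divergence `∑ p_i log (p_i / q_i)` (natural logarithm) of two vectors of
masses, for `q` with positive entries. A term with `p_i = 0` is `0`, as in the convention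
`0 log 0 = 0`. -/
noncomputable def discreteKL {k : ℕ} (p q : Fin k → ℝ) : ℝ :=
  ∑ i, p i * Real.log (p i / q i)

/-- `X 0, …, X (n - 1)` are independent random symbols, each with probability mass function `p`. -/
structure IsIIDSample {Ω : Type*} [MeasurableSpace Ω] (P : Measure Ω) {n k : ℕ}
    (p : Fin k → ℝ) (X : Fin n → Ω → Fin k) : Prop where
  measurable : ∀ j, Measurable (X j)
  indep : iIndepFun X P
  law : ∀ j i, P.real {ω | X j ω = i} = p i

/-- The loss `KL(p ‖ p̂)` of the Laplace estimator `p̂` of the random sample `X`. -/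
noncomputable def laplaceKL {Ω : Type*} {n k : ℕ} (p : Fin k → ℝ) (X : Fin n → Ω → Fin k)
    (ω : Ω) : ℝ :=
  discreteKL p (laplaceEstimator fun j => X j ω)

open MeasureTheory ProbabilityTheory

/-! Since the counts sum to `n`, `n * KL` equals `∑ i, poissonLoss (n p_i) (N_i + 1)` plus a
deterministic constant (`mul_discreteKL_laplaceEstimator`), so only this sum must be concentrated.
Each summand splits at its minimum into an antitone function of `N_i` (`lowerLoss`) and a monotone
one (`upperLoss`). For functions all monotone in the same direction, negative association
(`sampleMean_prod_symbolCount_le`) bounds the moment generating function of the sum by that of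
independent summands, so Hoeffding's inequality applies to each half once it is bounded.

Boundedness comes from truncation at `5 l ^ 2` and `3.4 l ^ 2`, with `l = log (4k/δ)`. By Chernoff
bounds each summand exceeds its level with probability at most `exp (-l) = δ/(4k)`. Truncation only
lowers the means, which is harmless for an upper deviation. Four bad events cost `δ/4` each. The
resulting `IsIIDSample.laplaceKL_le` has only the square-root term; the other two terms of the
theorem are nonnegative slack. -/

/-! ### Negative association of multinomial counts. -/

theorem one_add_sum_le_prod_one_add_of_same_sign {ι : Type*} (s : Finset ι) (x : ι → ℝ)
    (h1 : ∀ i, 0 ≤ 1 + x i) (hx : (∀ i, 0 ≤ x i) ∨ (∀ i, x i ≤ 0)) :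
    1 + ∑ i ∈ s, x i ≤ ∏ i ∈ s, (1 + x i) := by
  classical
  induction s using Finset.induction_on with
  | empty => simp
  | insert a s ha ih =>
    rw [Finset.sum_insert ha, Finset.prod_insert ha]
    have hmul : 0 ≤ x a * ∑ i ∈ s, x i := by
      rcases hx with hx | hx
      · exact mul_nonneg (hx a) (Finset.sum_nonneg fun i _ => hx i)
      · exact mul_nonneg_of_nonpos_of_nonpos (hx a) (Finset.sum_nonpos fun i _ => hx i)
    nlinarith [mul_le_mul_of_nonneg_left ih (h1 a)]

/-- The expectation of `F` under `n` independent draws from `p`. -/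
noncomputable def sampleMean {k : ℕ} (p : Fin k → ℝ) {n : ℕ} (F : (Fin n → Fin k) → ℝ) : ℝ :=
  ∑ x, (∏ j, p (x j)) * F x

theorem symbolCount_cons {n k : ℕ} (a : Fin k) (x : Fin n → Fin k) (i : Fin k) :
    symbolCount (Fin.cons a x : Fin (n + 1) → Fin k) i
      = symbolCount x i + if a = i then 1 else 0 := by
  unfold symbolCount
  simp only [Finset.card_filter, Fin.sum_univ_succ, Fin.cons_zero, Fin.cons_succ]
  omega

theorem sampleMean_succ {k : ℕ} (p : Fin k → ℝ) {n : ℕ} (F : (Fin (n + 1) → Fin k) → ℝ) :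
    sampleMean p F = ∑ a, p a * sampleMean p (fun x : Fin n → Fin k => F (Fin.cons a x)) := by
  unfold sampleMean
  rw [← (Fin.consEquiv fun _ => Fin k).sum_comp, Fintype.sum_prod_type]
  refine Finset.sum_congr rfl fun a _ => ?_
  rw [Finset.mul_sum]
  refine Finset.sum_congr rfl fun x _ => ?_
  simp [Fin.consEquiv, Fin.prod_univ_succ, mul_assoc]

theorem sampleMean_prod {k : ℕ} (p : Fin k → ℝ) {n : ℕ} (f : Fin k → ℝ) :
    sampleMean p (fun x : Fin n → Fin k => ∏ j, f (x j)) = (∑ a, p a * f a) ^ n := by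
  unfold sampleMean
  simp_rw [← Finset.prod_mul_distrib]
  rw [← Fintype.piFinset_univ,
    Finset.sum_prod_piFinset Finset.univ (fun (_ : Fin n) a => p a * f a)]
  simp

theorem sampleMean_const {k : ℕ} {p : Fin k → ℝ} (hp : p ∈ stdSimplex ℝ (Fin k)) {n : ℕ}
    (c : ℝ) : sampleMean p (fun _ : Fin n → Fin k => c) = c := by
  have h := sampleMean_prod p (n := n) (fun _ => 1)
  simp only [Finset.prod_const_one, mul_one, hp.2, one_pow] at h
  unfold sampleMean at h ⊢
  rw [← Finset.sum_mul]
  simp only [mul_one] at h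
  rw [h, one_mul]

theorem sampleMean_mono {k : ℕ} {p : Fin k → ℝ} (hp : p ∈ stdSimplex ℝ (Fin k)) {n : ℕ}
    {F G : (Fin n → Fin k) → ℝ} (h : ∀ x, F x ≤ G x) : sampleMean p F ≤ sampleMean p G :=
  Finset.sum_le_sum fun x _ =>
    mul_le_mul_of_nonneg_left (h x) (Finset.prod_nonneg fun _ _ => hp.1 _)

theorem sampleMean_pos {k : ℕ} {p : Fin k → ℝ} (hp : p ∈ stdSimplex ℝ (Fin k)) {n : ℕ}
    {F : (Fin n → Fin k) → ℝ} (h : ∀ x, 0 < F x) : 0 < sampleMean p F := by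
  have hne : (Finset.univ : Finset (Fin n → Fin k)).Nonempty := by
    by_contra hc
    have h1 := sampleMean_const hp (n := n) 1
    rw [Finset.not_nonempty_iff_eq_empty] at hc
    simp [sampleMean, hc] at h1
  obtain ⟨x0, -, hx0⟩ := Finset.exists_min_image Finset.univ F hne
  calc 0 < F x0 := h x0
    _ = sampleMean p (fun _ : Fin n → Fin k => F x0) := (sampleMean_const hp _).symm
    _ ≤ _ := sampleMean_mono hp fun x => hx0 x (Finset.mem_univ x)

/-- The counts of a multinomial sample are negatively associated. -/
theorem sampleMean_prod_symbolCount_le {k : ℕ} {p : Fin k → ℝ} (hp : p ∈ stdSimplex ℝ (Fin k))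
    (n : ℕ) (φ : Fin k → ℕ → ℝ) (hpos : ∀ i m, 0 < φ i m)
    (hmon : (∀ i, Monotone (φ i)) ∨ (∀ i, Antitone (φ i))) :
    sampleMean p (fun x : Fin n → Fin k => ∏ i, φ i (symbolCount x i))
      ≤ ∏ i, sampleMean p (fun x : Fin n → Fin k => φ i (symbolCount x i)) := by
  induction n generalizing φ with
  | zero => simp [sampleMean, symbolCount]
  | succ n ih =>
    set a : Fin k → ℝ := fun i => sampleMean p fun x : Fin n → Fin k => φ i (symbolCount x i)
      with ha
    set b : Fin k → ℝ := fun i => sampleMean p fun x : Fin n → Fin k => φ i (symbolCount x i + 1)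
      with hb
    have hapos : ∀ i, 0 < a i := fun i => sampleMean_pos hp fun x => hpos _ _
    have hbpos : ∀ i, 0 < b i := fun i => sampleMean_pos hp fun x => hpos _ _
    have hone : ∀ i, p i ≤ 1 := fun i => by
      rw [← hp.2]; exact Finset.single_le_sum (fun j _ => hp.1 j) (Finset.mem_univ i)
    -- Conditioning on the first symbol `j` shifts only the `j`-th count, so the induction
    -- hypothesis for the shifted family replaces the factor `a j` by `b j`.
    have hstep : ∀ j, sampleMean p (fun x : Fin n → Fin k =>
        ∏ i, φ i (symbolCount (Fin.cons j x : Fin (n + 1) → Fin k) i))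
        ≤ (∏ i, a i) * (b j / a j) := by
      intro j
      have key := ih (fun i m => φ i (m + if j = i then 1 else 0)) (fun i m => hpos _ _)
        (hmon.imp (fun h i m m' hm => h i (by omega)) (fun h i m m' hm => h i (by omega)))
      simp only [symbolCount_cons]
      refine key.trans (le_of_eq ?_)
      rw [← Finset.mul_prod_erase _ _ (Finset.mem_univ j),
        ← Finset.mul_prod_erase _ a (Finset.mem_univ j)]
      have h1 : ∏ i ∈ Finset.univ.erase j, sampleMean p (fun x : Fin n → Fin k =>
          φ i (symbolCount x i + if j = i then 1 else 0)) = ∏ i ∈ Finset.univ.erase j, a i := by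
        refine Finset.prod_congr rfl fun i hi => ?_
        rw [if_neg (Finset.ne_of_mem_erase hi).symm]
        rfl
      rw [h1]
      have := (hapos j).ne'
      simp only [if_true]
      change b j * _ = _
      field_simp
    have hmarg : ∀ i, sampleMean p (fun x : Fin (n + 1) → Fin k => φ i (symbolCount x i))
        = a i * (1 + p i * (b i / a i - 1)) := by
      intro i
      rw [sampleMean_succ]
      simp only [symbolCount_cons]
      have h1 : ∀ c, p c * sampleMean p (fun x : Fin n → Fin k =>
          φ i (symbolCount x i + if c = i then 1 else 0))
          = p c * a i + if c = i then p c * (b i - a i) else 0 := by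
        intro c
        split_ifs with h
        · change p c * b i = _
          ring
        · simp [ha]
      simp only [h1, Finset.sum_add_distrib, ← Finset.sum_mul, hp.2, Finset.sum_ite_eq',
        Finset.mem_univ, if_true]
      have := (hapos i).ne'
      field_simp
    rw [sampleMean_succ]
    simp only [hmarg, Finset.prod_mul_distrib]
    calc _ ≤ ∑ j, p j * ((∏ i, a i) * (b j / a j)) :=
          Finset.sum_le_sum fun j _ => mul_le_mul_of_nonneg_left (hstep j) (hp.1 j)
      _ = (∏ i, a i) * (1 + ∑ i, p i * (b i / a i - 1)) := by
          simp only [mul_sub, Finset.sum_sub_distrib, mul_one, hp.2]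
          rw [add_sub_cancel, Finset.mul_sum]
          exact Finset.sum_congr rfl fun j _ => by ring
      _ ≤ _ := by
          refine mul_le_mul_of_nonneg_left ?_ (Finset.prod_nonneg fun i _ => (hapos i).le)
          -- The common direction of monotonicity gives all `b i / a i - 1` the same sign.
          refine one_add_sum_le_prod_one_add_of_same_sign _ _ (fun i => ?_) ?_
          · have : 0 ≤ p i * (b i / a i) := mul_nonneg (hp.1 i) (div_pos (hbpos i) (hapos i)).le
            nlinarith [hone i]
          · refine hmon.imp (fun h i => mul_nonneg (hp.1 i) (sub_nonneg.2 ?_))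
              (fun h i => mul_nonpos_of_nonneg_of_nonpos (hp.1 i) (sub_nonpos.2 ?_))
            · rw [one_le_div (hapos i)]
              exact sampleMean_mono hp fun x => h i (Nat.le_succ _)
            · rw [div_le_one (hapos i)]
              exact sampleMean_mono hp fun x => h i (Nat.le_succ _)

theorem IsIIDSample.integral_eq_sampleMean {Ω : Type*} [MeasurableSpace Ω] {P : Measure Ω}
    [IsProbabilityMeasure P] {n k : ℕ} {p : Fin k → ℝ} {X : Fin n → Ω → Fin k}
    (hX : IsIIDSample P p X) (F : (Fin n → Fin k) → ℝ) :
    ∫ ω, F (fun j => X j ω) ∂P = sampleMean p F := by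
  have hm : Measurable fun ω j => X j ω := measurable_pi_lambda _ hX.measurable
  have := Measure.isProbabilityMeasure_map hm.aemeasurable (μ := P)
  rw [← integral_map hm.aemeasurable (f := F) (measurable_of_finite F).aestronglyMeasurable,
    integral_fintype .of_finite]
  refine Finset.sum_congr rfl fun x _ => ?_
  rw [smul_eq_mul, map_measureReal_apply hm (measurableSet_singleton x)]
  congr 1
  have hset : (fun ω j => X j ω) ⁻¹' {x} = ⋂ j ∈ Finset.univ, X j ⁻¹' {x j} := by
    ext ω; simp [funext_iff]
  rw [hset, measureReal_def, hX.indep.measure_inter_preimage_eq_mul Finset.univ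
    (fun j _ => measurableSet_singleton _), ENNReal.toReal_prod]
  exact Finset.prod_congr rfl fun j _ => hX.law j (x j)

/-! ### Hoeffding and Chernoff tail bounds for the counts. -/

section Tails

theorem IsIIDSample.measurable_comp {Ω : Type*} [MeasurableSpace Ω] {P : Measure Ω} {n k : ℕ}
    {p : Fin k → ℝ} {X : Fin n → Ω → Fin k} (hX : IsIIDSample P p X) (F : (Fin n → Fin k) → ℝ) :
    Measurable fun ω => F (fun j => X j ω) :=
  (measurable_of_finite F).comp (measurable_pi_lambda _ hX.measurable)

variable {Ω : Type*} [MeasurableSpace Ω] {P : Measure Ω} [IsProbabilityMeasure P] {n k : ℕ}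
  {p : Fin k → ℝ} {X : Fin n → Ω → Fin k}

theorem IsIIDSample.integrable_comp (hX : IsIIDSample P p X) (F : (Fin n → Fin k) → ℝ) :
    Integrable (fun ω => F (fun j => X j ω)) P := by
  obtain ⟨C, hC⟩ := (Set.finite_range fun x => |F x|).bddAbove
  exact Integrable.of_bound (hX.measurable_comp F).aestronglyMeasurable C
    (.of_forall fun ω => hC ⟨_, rfl⟩)

/-- Hoeffding's inequality for monotone functions of the counts of a multinomial sample. -/
theorem IsIIDSample.measureReal_sum_ge_le (hX : IsIIDSample P p X)
    (hp : p ∈ stdSimplex ℝ (Fin k)) (φ : Fin k → ℕ → ℝ)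
    (hmon : (∀ i, Monotone (φ i)) ∨ (∀ i, Antitone (φ i))) {B s : ℝ} (hB : 0 < B) (hs : 0 ≤ s)
    (hk : 0 < k) (hφ : ∀ i m, φ i m ∈ Set.Icc 0 B) :
    P.real {ω | (∑ i, ∫ ω', φ i (symbolCount (fun j => X j ω') i) ∂P) + s
        ≤ ∑ i, φ i (symbolCount (fun j => X j ω) i)}
      ≤ Real.exp (-(2 * s ^ 2 / (k * B ^ 2))) := by
  have hk' : (0 : ℝ) < k := by exact_mod_cast hk
  set m : Fin k → ℝ := fun i => ∫ ω', φ i (symbolCount (fun j => X j ω') i) ∂P with hm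
  -- Minimiser of `-l * s + k * B ^ 2 * l ^ 2 / 8`; its sign keeps `exp (l * φ)` monotone in the
  -- direction of `φ`.
  set l : ℝ := 4 * s / (k * B ^ 2) with hl
  have hl0 : 0 ≤ l := by positivity
  have hmgf : ∀ i, ∫ ω, Real.exp (l * φ i (symbolCount (fun j => X j ω) i)) ∂P
      ≤ Real.exp (l * m i + B ^ 2 * l ^ 2 / 8) := by
    intro i
    have h := (hasSubgaussianMGF_of_mem_Icc (μ := P)
      (X := fun ω => φ i (symbolCount (fun j => X j ω) i))
      (hX.measurable_comp fun x => φ i (symbolCount x i)).aemeasurable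
      (.of_forall fun ω => hφ i _)).mgf_le l
    have h2 : mgf (fun ω => φ i (symbolCount (fun j => X j ω) i) - m i) P l
        = (∫ ω, Real.exp (l * φ i (symbolCount (fun j => X j ω) i)) ∂P)
          * Real.exp (-(l * m i)) := by
      rw [mgf, ← integral_mul_const]
      refine integral_congr_ae (.of_forall fun ω => ?_)
      simp only [← Real.exp_add]
      congr 1
      ring
    change mgf (fun ω => φ i (symbolCount (fun j => X j ω) i) - m i) P l ≤ _ at h
    rw [h2] at h
    have h3 := mul_le_mul_of_nonneg_right h (Real.exp_nonneg (l * m i))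
    rw [mul_assoc, ← Real.exp_add, neg_add_cancel, Real.exp_zero, mul_one, ← Real.exp_add] at h3
    refine h3.trans (le_of_eq ?_)
    congr 1
    simp [abs_of_pos hB]
    ring
  have hna : ∫ ω, Real.exp (l * ∑ i, φ i (symbolCount (fun j => X j ω) i)) ∂P
      ≤ Real.exp (l * (∑ i, m i) + k * (B ^ 2 * l ^ 2 / 8)) := by
    calc _ = ∫ ω, ∏ i, Real.exp (l * φ i (symbolCount (fun j => X j ω) i)) ∂P := by
          simp only [Finset.mul_sum, Real.exp_sum]
      _ = sampleMean p fun x : Fin n → Fin k => ∏ i, Real.exp (l * φ i (symbolCount x i)) :=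
          hX.integral_eq_sampleMean fun x => ∏ i, Real.exp (l * φ i (symbolCount x i))
      _ ≤ ∏ i, sampleMean p fun x : Fin n → Fin k => Real.exp (l * φ i (symbolCount x i)) := by
          refine sampleMean_prod_symbolCount_le hp n (fun i m => Real.exp (l * φ i m))
            (fun _ _ => Real.exp_pos _) (hmon.imp (fun h i a b hab => ?_) fun h i a b hab => ?_)
          all_goals exact Real.exp_le_exp.2 (mul_le_mul_of_nonneg_left (h i hab) hl0)
      _ = ∏ i, ∫ ω, Real.exp (l * φ i (symbolCount (fun j => X j ω) i)) ∂P :=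
          Finset.prod_congr rfl fun i _ =>
            (hX.integral_eq_sampleMean fun x => Real.exp (l * φ i (symbolCount x i))).symm
      _ ≤ ∏ i, Real.exp (l * m i + B ^ 2 * l ^ 2 / 8) :=
          Finset.prod_le_prod (fun i _ => integral_nonneg fun _ => Real.exp_nonneg _)
            fun i _ => hmgf i
      _ = _ := by
          rw [← Real.exp_sum, Finset.sum_add_distrib, ← Finset.mul_sum]
          simp
  refine (measure_ge_le_exp_mul_mgf _ hl0
    (hX.integrable_comp fun x => Real.exp (l * ∑ i, φ i (symbolCount x i)))).trans ?_
  refine (mul_le_mul_of_nonneg_left hna (Real.exp_nonneg _)).trans ?_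
  rw [← Real.exp_add, Real.exp_le_exp, hl]
  apply le_of_eq
  field_simp
  ring

/-- The binomial moment generating function `(1 + p (e^l - 1)) ^ n` is dominated by the Poisson one
through `1 + x ≤ exp x`. -/
theorem IsIIDSample.mgf_symbolCount_le (hX : IsIIDSample P p X)
    (hp : p ∈ stdSimplex ℝ (Fin k)) (i : Fin k) (l : ℝ) :
    mgf (fun ω => (symbolCount (fun j => X j ω) i : ℝ)) P l
      ≤ Real.exp (n * p i * (Real.exp l - 1)) := by
  have h1 : ∀ x : Fin n → Fin k, Real.exp (l * symbolCount x i)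
      = ∏ j, if x j = i then Real.exp l else 1 := by
    intro x
    rw [Finset.prod_ite]
    simp [symbolCount, ← Real.exp_nat_mul, mul_comm]
  have h2 : ∑ a, p a * (if a = i then Real.exp l else 1) = 1 + p i * (Real.exp l - 1) := by
    have : ∀ a, p a * (if a = i then Real.exp l else 1)
        = p a + if a = i then p a * (Real.exp l - 1) else 0 := by
      intro a; split_ifs <;> ring
    simp only [this, Finset.sum_add_distrib, hp.2, Finset.sum_ite_eq', Finset.mem_univ, if_true]
  have h3 : mgf (fun ω => (symbolCount (fun j => X j ω) i : ℝ)) P l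
      = (1 + p i * (Real.exp l - 1)) ^ n := by
    rw [mgf, hX.integral_eq_sampleMean fun x => Real.exp (l * symbolCount x i)]
    simp only [h1]
    rw [sampleMean_prod p (fun a => if a = i then Real.exp l else 1), h2]
  have hp1 : p i ≤ 1 := by
    rw [← hp.2]; exact Finset.single_le_sum (fun j _ => hp.1 j) (Finset.mem_univ i)
  rw [h3, mul_assoc, Real.exp_nat_mul]
  refine pow_le_pow_left₀ ?_ (by linarith [Real.add_one_le_exp (p i * (Real.exp l - 1))]) n
  nlinarith [mul_nonneg (hp.1 i) (Real.exp_nonneg l)]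

/-- Follows from `(1 - x + x²/2) (1 + x + x²/2) = 1 + x⁴/4 ≥ 1`. -/
theorem exp_neg_le_one_sub_add_sq_half {x : ℝ} (hx : 0 ≤ x) :
    Real.exp (-x) ≤ 1 - x + x ^ 2 / 2 := by
  rw [Real.exp_neg, inv_le_comm₀ (Real.exp_pos x) (by nlinarith [sq_nonneg (x - 1)])]
  refine le_trans ?_ (Real.quadratic_le_exp_of_nonneg hx)
  rw [inv_le_iff_one_le_mul₀' (by nlinarith [sq_nonneg (x - 1)])]
  nlinarith [sq_nonneg (x ^ 2)]

theorem exp_le_one_add_add_sq {x : ℝ} (h0 : 0 ≤ x) (h1 : x ≤ 1) :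
    Real.exp x ≤ 1 + x + x ^ 2 := by
  have := abs_le.1 (Real.abs_exp_sub_one_sub_id_le (x := x) (by rwa [abs_of_nonneg h0]))
  linarith [this.2]

theorem IsIIDSample.measureReal_symbolCount_le (hX : IsIIDSample P p X)
    (hp : p ∈ stdSimplex ℝ (Fin k)) (i : Fin k) (hi : 0 < n * p i) {l : ℝ} (hl : 0 ≤ l) :
    P.real {ω | (symbolCount (fun j => X j ω) i : ℝ) ≤ n * p i - √(2 * (n * p i) * l)}
      ≤ Real.exp (-l) := by
  set m := n * p i with hm
  set t := √(2 * m * l) with ht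
  have ht2 : t ^ 2 = 2 * m * l := Real.sq_sqrt (by positivity)
  have hlam : 0 ≤ t / m := by positivity
  refine (measure_le_le_exp_mul_mgf _ (neg_nonpos.2 hlam)
    (hX.integrable_comp fun x => Real.exp (-(t / m) * symbolCount x i))).trans ?_
  refine (mul_le_mul_of_nonneg_left (hX.mgf_symbolCount_le hp i _) (Real.exp_nonneg _)).trans ?_
  rw [← Real.exp_add, Real.exp_le_exp, ← hm]
  have h := mul_le_mul_of_nonneg_left (exp_neg_le_one_sub_add_sq_half hlam) hi.le
  have h2 : m * (1 - t / m + (t / m) ^ 2 / 2) = m - t + l := by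
    field_simp
    rw [ht2]; ring
  have h3 : -(-(t / m)) * (m - t) = t - 2 * l := by
    field_simp
    rw [mul_sub, ← sq, ht2]; ring
  rw [h2] at h
  linarith

theorem IsIIDSample.measureReal_le_symbolCount (hX : IsIIDSample P p X)
    (hp : p ∈ stdSimplex ℝ (Fin k)) (i : Fin k) {l : ℝ} (h0 : 0 < l) (hl : l ≤ n * p i) :
    P.real {ω | n * p i + 2 * √(n * p i * l) ≤ (symbolCount (fun j => X j ω) i : ℝ)}
      ≤ Real.exp (-l) := by
  set m := n * p i with hm
  set t := √(m * l) with ht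
  have hm0 : 0 < m := h0.trans_le hl
  have ht2 : t ^ 2 = m * l := Real.sq_sqrt (by positivity)
  have hlam : 0 ≤ t / m := by positivity
  -- The parameter is `√(l/m)`; `l ≤ m` keeps it in the range where `exp x ≤ 1 + x + x²`.
  have hlam1 : t / m ≤ 1 := by
    rw [div_le_one hm0]
    exact abs_le_of_sq_le_sq' (by nlinarith) hm0.le |>.2
  refine (measure_ge_le_exp_mul_mgf _ hlam
    (hX.integrable_comp fun x => Real.exp (t / m * symbolCount x i))).trans ?_
  refine (mul_le_mul_of_nonneg_left (hX.mgf_symbolCount_le hp i _) (Real.exp_nonneg _)).trans ?_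
  rw [← Real.exp_add, Real.exp_le_exp, ← hm]
  have h := mul_le_mul_of_nonneg_left (exp_le_one_add_add_sq hlam hlam1) hm0.le
  have h2 : m * (1 + t / m + (t / m) ^ 2) = m + t + l := by
    field_simp
    rw [ht2]; ring
  have h3 : -(t / m) * (m + 2 * t) = -t - 2 * l := by
    field_simp
    linear_combination -2 * ht2
  rw [h2] at h
  linarith

/-- For small means the Chernoff parameter `1` suffices: the exponent is `(e - 2) n p_i - 2 l ≤ -l`.
-/
theorem IsIIDSample.measureReal_le_symbolCount_of_le (hX : IsIIDSample P p X)
    (hp : p ∈ stdSimplex ℝ (Fin k)) (i : Fin k) {l : ℝ} (hl : n * p i ≤ l) :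
    P.real {ω | n * p i + 2 * l ≤ (symbolCount (fun j => X j ω) i : ℝ)} ≤ Real.exp (-l) := by
  refine (measure_ge_le_exp_mul_mgf _ zero_le_one
    (hX.integrable_comp fun x => Real.exp (1 * symbolCount x i))).trans ?_
  refine (mul_le_mul_of_nonneg_left (hX.mgf_symbolCount_le hp i _) (Real.exp_nonneg _)).trans ?_
  rw [← Real.exp_add, Real.exp_le_exp]
  have h0 : 0 ≤ n * p i := mul_nonneg n.cast_nonneg (hp.1 i)
  nlinarith [Real.exp_one_lt_d9]

end Tails

/-! ### The loss of one symbol: monotonicity, quadratic bounds, truncation levels. -/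

/-- The excess of `u - m log u` over its minimum, attained at `u = m`. -/
noncomputable def poissonLoss (m u : ℝ) : ℝ :=
  u - m - m * Real.log u + m * Real.log m

theorem poissonLoss_self (m : ℝ) : poissonLoss m m = 0 := by
  unfold poissonLoss; ring

theorem poissonLoss_le_of_le {m u v : ℝ} (hm : 0 ≤ m) (hu : 0 < u) (hmu : m ≤ u) (huv : u ≤ v) :
    poissonLoss m u ≤ poissonLoss m v := by
  have h := Real.log_le_sub_one_of_pos (div_pos (hu.trans_le huv) hu)
  rw [Real.log_div (hu.trans_le huv).ne' hu.ne', div_sub_one hu.ne'] at h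
  have h2 : m * ((v - u) / u) ≤ v - u := by
    rw [mul_div_assoc', div_le_iff₀ hu]
    nlinarith
  unfold poissonLoss
  nlinarith [mul_le_mul_of_nonneg_left h hm]

theorem poissonLoss_le_of_ge {m u v : ℝ} (hu : 0 < u) (huv : u ≤ v) (hvm : v ≤ m) :
    poissonLoss m v ≤ poissonLoss m u := by
  have hv := hu.trans_le huv
  have hm := hv.trans_le hvm
  have h := Real.one_sub_inv_le_log_of_pos (div_pos hv hu)
  rw [Real.log_div hv.ne' hu.ne', inv_div] at h
  have h2 : v - u ≤ m * (1 - u / v) := by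
    rw [one_sub_div hv.ne', mul_div_assoc', le_div_iff₀ hv]
    nlinarith
  unfold poissonLoss
  nlinarith [mul_le_mul_of_nonneg_left h hm.le]

theorem poissonLoss_min_add_max (m u : ℝ) :
    poissonLoss m (min u m) + poissonLoss m (max u m) = poissonLoss m u := by
  rcases le_total u m with h | h <;> simp [h, poissonLoss_self]

theorem poissonLoss_le_sq_div {m u : ℝ} (hu : 0 < u) (hum : u ≤ m) :
    poissonLoss m u ≤ (m - u) ^ 2 / u := by
  have hm := hu.trans_le hum
  have h := Real.log_le_sub_one_of_pos (div_pos hm hu)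
  rw [Real.log_div hm.ne' hu.ne'] at h
  have h2 : (m - u) ^ 2 / u = u - m + m * (m / u - 1) := by field_simp; ring
  unfold poissonLoss
  rw [h2]
  nlinarith [mul_le_mul_of_nonneg_left h hm.le]

theorem poissonLoss_add_le {m y : ℝ} (hm : 0 ≤ m) (hy : 0 ≤ y) : poissonLoss m (m + y) ≤ y := by
  unfold poissonLoss
  rcases hm.eq_or_lt with rfl | hm
  · simp
  · nlinarith [mul_le_mul_of_nonneg_left (Real.log_le_log hm (le_add_of_nonneg_right hy)) hm.le]

theorem poissonLoss_add_le_sq_div {m y : ℝ} (hm : 0 < m) (hy : 0 ≤ y) :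
    poissonLoss m (m + y) ≤ y ^ 2 / (2 * m) := by
  have h := Real.le_log_one_add_of_nonneg (div_nonneg hy hm.le)
  have h1 : 1 + y / m = (m + y) / m := by field_simp
  rw [h1, Real.log_div (by positivity) hm.ne'] at h
  have h2 : y - m * (2 * (y / m) / (y / m + 2)) = y ^ 2 / (2 * m + y) := by
    field_simp; ring
  have h3 : y ^ 2 / (2 * m + y) ≤ y ^ 2 / (2 * m) := by gcongr; linarith
  unfold poissonLoss
  nlinarith [mul_le_mul_of_nonneg_left h hm.le]

/-- The part of `poissonLoss m (N + 1)` caused by `N + 1 < m`. -/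
noncomputable def lowerLoss (m : ℝ) (N : ℕ) : ℝ := poissonLoss m (min (N + 1) m)

/-- The part of `poissonLoss m (N + 1)` caused by `N + 1 > m`. -/
noncomputable def upperLoss (m : ℝ) (N : ℕ) : ℝ := poissonLoss m (max (N + 1) m)

theorem lowerLoss_antitone {m : ℝ} (hm : 0 ≤ m) : Antitone (lowerLoss m) := by
  intro a b hab
  have ha : (0 : ℝ) < a + 1 := by positivity
  have hab' : (a : ℝ) + 1 ≤ b + 1 := by exact_mod_cast Nat.succ_le_succ hab
  unfold lowerLoss
  rcases hm.eq_or_lt with rfl | hm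
  · rw [min_eq_right ha.le, min_eq_right (ha.le.trans hab')]
  · exact poissonLoss_le_of_ge (lt_min ha hm) (min_le_min_right m hab') (min_le_right _ _)

theorem upperLoss_monotone {m : ℝ} (hm : 0 ≤ m) : Monotone (upperLoss m) := by
  intro a b hab
  have ha : (0 : ℝ) < a + 1 := by positivity
  have hab' : (a : ℝ) + 1 ≤ b + 1 := by exact_mod_cast Nat.succ_le_succ hab
  exact poissonLoss_le_of_le hm (lt_max_of_lt_left ha) (le_max_right _ _)
    (max_le_max_right m hab')

theorem lowerLoss_nonneg {m : ℝ} (hm : 0 ≤ m) (N : ℕ) : 0 ≤ lowerLoss m N := by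
  rw [← poissonLoss_self m]
  have hN : (0 : ℝ) < N + 1 := by positivity
  unfold lowerLoss
  rcases hm.eq_or_lt with rfl | hm
  · rw [min_eq_right hN.le]
  · exact poissonLoss_le_of_ge (lt_min hN hm) (min_le_right _ _) le_rfl

theorem upperLoss_nonneg {m : ℝ} (hm : 0 ≤ m) (N : ℕ) : 0 ≤ upperLoss m N := by
  rw [← poissonLoss_self m]
  have hN : (0 : ℝ) < N + 1 := by positivity
  unfold upperLoss
  rcases hm.eq_or_lt with rfl | hm
  · rw [max_eq_left hN.le]
    simp [poissonLoss, hN.le]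
  · exact poissonLoss_le_of_le hm.le hm le_rfl (le_max_right _ _)

theorem lowerLoss_add_upperLoss (m : ℝ) (N : ℕ) :
    lowerLoss m N + upperLoss m N = poissonLoss m (N + 1) :=
  poissonLoss_min_add_max _ _

theorem log_four_lt : Real.log 4 < 1.3863 := by
  rw [show (4 : ℝ) = 2 ^ 2 by norm_num, Real.log_pow]
  push_cast
  linarith [Real.log_two_lt_d9]

theorem lt_log_four : 1.3862 < Real.log 4 := by
  rw [show (4 : ℝ) = 2 ^ 2 by norm_num, Real.log_pow]
  push_cast
  linarith [Real.log_two_gt_d9]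

/-- If `m ≤ 4 l`, the add-one term keeps the argument at least `1`, at a cost of at most about `m
log m`. If `m > 4 l`, the count is at least `(1 - 1/√2) m`, and the quadratic bound gives at most
about `6.83 l`, which is below `5 l ^ 2` because `l ≥ 1.386`. -/
theorem lowerLoss_le {m l : ℝ} (hm : 0 ≤ m) (hl : 1.386 ≤ l) {N : ℕ}
    (hN : 0 < m → m - √(2 * m * l) < N) : lowerLoss m N ≤ 5 * l ^ 2 := by
  have hN0 : (1 : ℝ) ≤ N + 1 := by simp
  unfold lowerLoss
  rcases le_or_gt m (4 * l) with h | h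
  · rcases le_or_gt m 1 with h1 | h1
    · rw [min_eq_right (h1.trans hN0), poissonLoss_self]
      positivity
    · refine (poissonLoss_le_of_ge one_pos (le_min hN0 h1.le) (min_le_right _ _)).trans ?_
      have h2 : Real.log m ≤ l + 0.3863 := by
        have h3 := Real.log_le_log (by linarith) h
        rw [Real.log_mul (by norm_num) (by linarith)] at h3
        linarith [Real.log_le_sub_one_of_pos (show 0 < l by linarith), log_four_lt]
      unfold poissonLoss
      rw [Real.log_one]
      nlinarith [mul_le_mul_of_nonneg_left h2 hm,
        mul_nonneg (sub_nonneg.2 h) (show 0 ≤ l - 0.6137 by linarith)]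
  · have hm0 : 0 < m := by linarith
    set t := √(2 * m * l) with ht
    have ht2 : t ^ 2 = 2 * m * l := Real.sq_sqrt (by positivity)
    have ht0 : 0 ≤ t := Real.sqrt_nonneg _
    have htm : t ≤ 0.7072 * m := by
      refine abs_le_of_sq_le_sq' ?_ (by positivity) |>.2
      nlinarith
    have hmt : 0 < m - t := by linarith
    have hN' := hN hm0
    refine (poissonLoss_le_of_ge hmt (le_min (by linarith) (by linarith))
      (min_le_right _ _)).trans ?_
    refine (poissonLoss_le_sq_div hmt (by linarith)).trans ?_
    rw [sub_sub_cancel, div_le_iff₀ hmt, ht2]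
    have h1 : 2 * m * l ≤ 5 * l ^ 2 * (0.2928 * m) := by
      nlinarith [mul_nonneg (mul_nonneg hm (show 0 ≤ l by linarith)) (sub_nonneg.2 hl)]
    refine h1.trans (mul_le_mul_of_nonneg_left (by linarith) (by positivity))

theorem upperLoss_le {m l : ℝ} (hm : 0 ≤ m) (hl : 1.386 ≤ l) {N : ℕ}
    (hN : (N : ℝ) < m + if l ≤ m then 2 * √(m * l) else 2 * l) : upperLoss m N ≤ 3.4 * l ^ 2 := by
  have hN0 : (0 : ℝ) < N + 1 := by positivity
  unfold upperLoss
  have key : ∀ y : ℝ, 0 ≤ y → (N : ℝ) + 1 ≤ m + y →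
      poissonLoss m (max (N + 1) m) ≤ poissonLoss m (m + y) := fun y hy hNy =>
    poissonLoss_le_of_le hm (lt_max_of_lt_left hN0) (le_max_right _ _)
      (max_le hNy (by linarith))
  split_ifs at hN with h
  · have hm0 : 0 < m := by linarith
    set s := √(m * l) with hs
    have hs2 : s ^ 2 = m * l := Real.sq_sqrt (by nlinarith)
    have hs0 : 0 ≤ s := Real.sqrt_nonneg _
    have hsl : l ≤ s := Real.le_sqrt_of_sq_le (by nlinarith)
    refine (key (2 * s + 1) (by linarith) (by linarith)).trans ?_
    refine (poissonLoss_add_le_sq_div hm0 (by linarith)).trans ?_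
    rw [div_le_iff₀ (by linarith)]
    -- Here `1 ≤ 0.722 s`, since `s ≥ l ≥ 1.386`.
    have h1 : (2 * s + 1) ^ 2 ≤ (2.722 * s) ^ 2 :=
      pow_le_pow_left₀ (by linarith) (by linarith) 2
    rw [mul_pow, hs2] at h1
    nlinarith [mul_nonneg (mul_nonneg hm (show 0 ≤ l by linarith)) (sub_nonneg.2 hl)]
  · refine (key (2 * l + 1) (by linarith) (by linarith)).trans ?_
    refine (poissonLoss_add_le hm (by linarith)).trans ?_
    nlinarith

theorem sum_symbolCount {n k : ℕ} (x : Fin n → Fin k) : ∑ i, symbolCount x i = n := by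
  unfold symbolCount
  rw [← Finset.card_eq_sum_card_fiberwise (fun _ _ => Finset.mem_coe.2 (Finset.mem_univ _))]
  simp

theorem mul_discreteKL_laplaceEstimator {n k : ℕ} (hn : 0 < n) {p : Fin k → ℝ}
    (hp : p ∈ stdSimplex ℝ (Fin k)) (x : Fin n → Fin k) :
    n * discreteKL p (laplaceEstimator x)
      = ∑ i, poissonLoss (n * p i) (symbolCount x i + 1)
        + (n * (Real.log (n + k) - Real.log n) - k) := by
  have hn' : (0 : ℝ) < n := by exact_mod_cast hn
  have hterm : ∀ i, n * (p i * Real.log (p i / laplaceEstimator x i))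
      = poissonLoss (n * p i) (symbolCount x i + 1) + (n * (Real.log (n + k) - Real.log n) + n)
        * p i - (symbolCount x i + 1) := by
    intro i
    unfold poissonLoss laplaceEstimator addConstEstimator
    have hN : (0 : ℝ) < symbolCount x i + 1 := by positivity
    have hnk : (0 : ℝ) < n + k * 1 := by positivity
    rcases (hp.1 i).eq_or_lt with h | h
    -- When `p i = 0`, the value `poissonLoss 0 (N + 1) = N + 1` cancels the subtracted count.
    · simp [← h]
    · rw [Real.log_div h.ne' (by positivity), Real.log_div hN.ne' hnk.ne',
        Real.log_mul hn'.ne' h.ne', mul_one]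
      ring
  have hsum : ∑ i, (symbolCount x i : ℝ) = n := by exact_mod_cast sum_symbolCount x
  unfold discreteKL
  rw [Finset.mul_sum]
  simp only [hterm, Finset.sum_add_distrib, Finset.sum_sub_distrib, ← Finset.mul_sum, hp.2, hsum]
  simp
  ring

/-! ### Union bound, assembly and the simplified rate. -/

section Main

variable {Ω : Type*} [MeasurableSpace Ω] {P : Measure Ω} [IsProbabilityMeasure P] {n k : ℕ}
  {p : Fin k → ℝ} {X : Fin n → Ω → Fin k}

theorem IsIIDSample.measureReal_lt_lowerLoss (hX : IsIIDSample P p X)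
    (hp : p ∈ stdSimplex ℝ (Fin k)) (i : Fin k) {l : ℝ} (hl : 1.386 ≤ l) :
    P.real {ω | 5 * l ^ 2 < lowerLoss (n * p i) (symbolCount (fun j => X j ω) i)}
      ≤ Real.exp (-l) := by
  have h0 : 0 ≤ n * p i := mul_nonneg n.cast_nonneg (hp.1 i)
  by_cases hi : 0 < n * p i
  · refine (measureReal_mono fun ω hω => ?_).trans
      (hX.measureReal_symbolCount_le hp i hi (l := l) (by linarith))
    by_contra hc
    exact absurd (lowerLoss_le h0 hl fun _ => not_le.1 hc) (not_le.2 hω)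
  · refine le_trans (le_of_eq ?_) (Real.exp_nonneg _)
    rw [Set.eq_empty_of_forall_notMem
      (s := {ω | 5 * l ^ 2 < lowerLoss (n * p i) (symbolCount (fun j => X j ω) i)})
      (fun ω hω => absurd (lowerLoss_le h0 hl fun h => absurd h hi) (not_le.2 hω)),
      measureReal_empty]

theorem IsIIDSample.measureReal_lt_upperLoss (hX : IsIIDSample P p X)
    (hp : p ∈ stdSimplex ℝ (Fin k)) (i : Fin k) {l : ℝ} (hl : 1.386 ≤ l) :
    P.real {ω | 3.4 * l ^ 2 < upperLoss (n * p i) (symbolCount (fun j => X j ω) i)}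
      ≤ Real.exp (-l) := by
  have h0 : 0 ≤ n * p i := mul_nonneg n.cast_nonneg (hp.1 i)
  have hsub : {ω | 3.4 * l ^ 2 < upperLoss (n * p i) (symbolCount (fun j => X j ω) i)}
      ⊆ {ω | n * p i + (if l ≤ n * p i then 2 * √(n * p i * l) else 2 * l)
        ≤ (symbolCount (fun j => X j ω) i : ℝ)} := by
    intro ω hω
    by_contra hc
    exact absurd (upperLoss_le h0 hl (not_le.1 hc)) (not_le.2 hω)
  refine (measureReal_mono hsub).trans ?_
  split_ifs with h
  · exact hX.measureReal_le_symbolCount hp i (by linarith) h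
  · exact hX.measureReal_le_symbolCount_of_le hp i (not_le.1 h).le

theorem IsIIDSample.mul_integral_laplaceKL (hX : IsIIDSample P p X) (hn : 0 < n)
    (hp : p ∈ stdSimplex ℝ (Fin k)) :
    n * ∫ ω, laplaceKL p X ω ∂P
      = ∑ i, ∫ ω, poissonLoss (n * p i) (symbolCount (fun j => X j ω) i + 1) ∂P
        + (n * (Real.log (n + k) - Real.log n) - k) := by
  rw [← integral_const_mul]
  simp only [laplaceKL, mul_discreteKL_laplaceEstimator hn hp]
  rw [integral_add (hX.integrable_comp fun x =>
      ∑ i, poissonLoss (n * p i) (symbolCount x i + 1)) (integrable_const _),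
    integral_finsetSum _ fun i _ => hX.integrable_comp fun x =>
      poissonLoss (n * p i) (symbolCount x i + 1)]
  simp

/-- The upper deviation of the loss of the Laplace estimator is `O(√(k log⁵(k/δ)) / n)`. -/
theorem IsIIDSample.laplaceKL_le (hX : IsIIDSample P p X) (hn : 0 < n)
    (hp : p ∈ stdSimplex ℝ (Fin k)) {δ : ℝ} (hδ : 0 < δ) (hδ1 : δ ≤ 1) :
    1 - δ ≤ P.real {ω | laplaceKL p X ω ≤ (∫ ω', laplaceKL p X ω' ∂P)
      + 6 * √((k : ℝ) * Real.log (4 * (k : ℝ) / δ) ^ 5) / (n : ℝ)} := by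
  have hk : 0 < k := by
    rcases Nat.eq_zero_or_pos k with rfl | h
    · simpa using hp.2
    · exact h
  have hk1 : (1 : ℝ) ≤ k := by exact_mod_cast hk
  have hn' : (0 : ℝ) < n := by exact_mod_cast hn
  have hq : 4 ≤ 4 * (k : ℝ) / δ := by rw [le_div_iff₀ hδ]; nlinarith
  set l := Real.log (4 * (k : ℝ) / δ) with hldef
  have hl : 1.386 ≤ l := by
    linarith [Real.log_le_log (by norm_num) hq, lt_log_four]
  have hexp : Real.exp (-l) = δ / (4 * k) := by
    rw [Real.exp_neg, Real.exp_log (by positivity), inv_div]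
  set S := √((k : ℝ) * l ^ 5) with hS
  have hS0 : 0 ≤ S := Real.sqrt_nonneg _
  have hS2 : S ^ 2 = k * l ^ 5 := Real.sq_sqrt (by positivity)
  have hm : ∀ i, 0 ≤ n * p i := fun i => mul_nonneg n.cast_nonneg (hp.1 i)
  set N : Fin k → Ω → ℕ := fun i ω => symbolCount (fun j => X j ω) i with hN
  set φ : Fin k → ℕ → ℝ := fun i a => min (lowerLoss (n * p i) a) (5 * l ^ 2) with hφ
  set ψ : Fin k → ℕ → ℝ := fun i a => min (upperLoss (n * p i) a) (3.4 * l ^ 2) with hψ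
  set A := ⋃ i, {ω | 5 * l ^ 2 < lowerLoss (n * p i) (N i ω)} with hA
  set B := ⋃ i, {ω | 3.4 * l ^ 2 < upperLoss (n * p i) (N i ω)} with hB
  -- Hoeffding at range `B` needs a deviation of at least `B √(k l / 2)`: `3.55 ≥ 5/√2` and `2.45 ≥
  -- 3.4/√2`, with `3.55 + 2.45 = 6`.
  set C := {ω | (∑ i, ∫ ω', φ i (N i ω') ∂P) + 3.55 * S ≤ ∑ i, φ i (N i ω)} with hC
  set D := {ω | (∑ i, ∫ ω', ψ i (N i ω') ∂P) + 2.45 * S ≤ ∑ i, ψ i (N i ω)} with hD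
  have hle : Real.exp (-l) ≤ δ / 4 := by
    rw [hexp]; gcongr; linarith
  have hunion : ∀ s : Fin k → Set Ω, (∀ i, P.real (s i) ≤ Real.exp (-l)) →
      P.real (⋃ i, s i) ≤ δ / 4 := by
    intro s hs
    refine (measureReal_iUnion_fintype_le s).trans
      ((Finset.sum_le_sum fun i _ => hs i).trans (le_of_eq ?_))
    rw [Finset.sum_const, Finset.card_univ, Fintype.card_fin, nsmul_eq_mul, hexp]
    field_simp
  have hPA : P.real A ≤ δ / 4 := hunion _ fun i => hX.measureReal_lt_lowerLoss hp i hl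
  have hPB : P.real B ≤ δ / 4 := hunion _ fun i => hX.measureReal_lt_upperLoss hp i hl
  have hPC : P.real C ≤ δ / 4 := by
    refine (hX.measureReal_sum_ge_le hp φ (.inr fun i a b hab =>
      min_le_min_right _ (lowerLoss_antitone (hm i) hab)) (B := 5 * l ^ 2) (by positivity)
      (by positivity) hk fun i a => ⟨le_min (lowerLoss_nonneg (hm i) a) (by positivity),
        min_le_right _ _⟩).trans (le_trans (Real.exp_le_exp.2 (neg_le_neg ?_)) hle)
    rw [le_div_iff₀ (by positivity), mul_pow, mul_pow, hS2]
    nlinarith [show 0 ≤ k * l ^ 5 by positivity]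
  have hPD : P.real D ≤ δ / 4 := by
    refine (hX.measureReal_sum_ge_le hp ψ (.inl fun i a b hab =>
      min_le_min_right _ (upperLoss_monotone (hm i) hab)) (B := 3.4 * l ^ 2) (by positivity)
      (by positivity) hk fun i a => ⟨le_min (upperLoss_nonneg (hm i) a) (by positivity),
        min_le_right _ _⟩).trans (le_trans (Real.exp_le_exp.2 (neg_le_neg ?_)) hle)
    rw [le_div_iff₀ (by positivity), mul_pow, mul_pow, hS2]
    nlinarith [show 0 ≤ k * l ^ 5 by positivity]
  set G := {ω | laplaceKL p X ω ≤ (∫ ω', laplaceKL p X ω' ∂P) + 6 * S / (n : ℝ)} with hG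
  have hmean : ∑ i, ∫ ω, φ i (N i ω) ∂P + ∑ i, ∫ ω, ψ i (N i ω) ∂P
      ≤ ∑ i, ∫ ω, poissonLoss (n * p i) (N i ω + 1) ∂P := by
    rw [← Finset.sum_add_distrib]
    refine Finset.sum_le_sum fun i _ => ?_
    have h1 := hX.integrable_comp fun x => φ i (symbolCount x i)
    have h2 := hX.integrable_comp fun x => ψ i (symbolCount x i)
    rw [← integral_add h1 h2]
    refine integral_mono (h1.add h2)
      (hX.integrable_comp fun x => poissonLoss (n * p i) (symbolCount x i + 1)) fun ω => ?_
    simp only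
    rw [← lowerLoss_add_upperLoss]
    exact add_le_add (min_le_left _ _) (min_le_left _ _)
  have hcover : Set.univ ⊆ G ∪ (A ∪ B ∪ (C ∪ D)) := by
    intro ω _
    by_contra hω
    simp only [Set.mem_union, not_or] at hω
    obtain ⟨hωG, ⟨hωA, hωB⟩, hωC, hωD⟩ := hω
    refine hωG ?_
    simp only [hA, hB, hC, hD, Set.mem_iUnion, Set.mem_ofPred_eq, not_exists, not_lt, not_le]
      at hωA hωB hωC hωD
    -- Outside `A` and `B` no truncation is active.
    have hsum : ∑ i, poissonLoss (n * p i) (N i ω + 1)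
        = ∑ i, φ i (N i ω) + ∑ i, ψ i (N i ω) := by
      rw [← Finset.sum_add_distrib]
      refine Finset.sum_congr rfl fun i _ => ?_
      rw [← lowerLoss_add_upperLoss]
      simp only [hφ, hψ]
      rw [min_eq_left (hωA i), min_eq_left (hωB i)]
    have h1 : n * laplaceKL p X ω = _ :=
      mul_discreteKL_laplaceEstimator hn hp fun j => X j ω
    have h2 := hX.mul_integral_laplaceKL hn hp
    change n * laplaceKL p X ω = ∑ i, poissonLoss (n * p i) (N i ω + 1) + _ at h1
    change n * (∫ ω, laplaceKL p X ω ∂P)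
      = ∑ i, ∫ ω, poissonLoss (n * p i) (N i ω + 1) ∂P + _ at h2
    change laplaceKL p X ω ≤ (∫ ω', laplaceKL p X ω' ∂P) + 6 * S / n
    rw [← mul_le_mul_iff_right₀ hn', mul_add, mul_div_cancel₀ _ hn'.ne', h1, h2, hsum]
    linarith
  have hprob := measureReal_mono (μ := P) hcover
  rw [probReal_univ] at hprob
  linarith [measureReal_union_le (μ := P) G (A ∪ B ∪ (C ∪ D)),
    measureReal_union_le (μ := P) (A ∪ B) (C ∪ D), measureReal_union_le (μ := P) A B,
    measureReal_union_le (μ := P) C D]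

theorem discreteKL_laplaceEstimator_of_eq_one (hp : p ∈ stdSimplex ℝ (Fin k)) (hk : k = 1)
    (x : Fin n → Fin k) : discreteKL p (laplaceEstimator x) = 0 := by
  subst hk
  have h1 : p 0 = 1 := by simpa using hp.2
  have h2 : symbolCount x 0 = n := by simpa using sum_symbolCount x
  have h3 : (n : ℝ) + 1 ≠ 0 := by positivity
  simp [discreteKL, laplaceEstimator, addConstEstimator, h1, h2, h3]

/-- As `k/δ ≥ 2`, one has `4 ≤ (k/δ)²` and `log (4k/δ) ≤ 3 log (k/δ)`; then `3⁵ = 243 ≤ 16²`. -/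
theorem sqrt_mul_log_pow_le {k : ℕ} (hk : 2 ≤ k) {δ : ℝ} (hδ : 0 < δ) (hδ1 : δ ≤ 1) :
    √((k : ℝ) * Real.log (4 * (k : ℝ) / δ) ^ 5)
      ≤ 16 * (√(k : ℝ) * Real.log ((k : ℝ) / δ) ^ (5 / 2 : ℝ)) := by
  have hk' : (2 : ℝ) ≤ k := by exact_mod_cast hk
  have hq : 2 ≤ (k : ℝ) / δ := by rw [le_div_iff₀ hδ]; nlinarith
  set l := Real.log ((k : ℝ) / δ) with hl
  have hl2 : Real.log 2 ≤ l := Real.log_le_log two_pos hq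
  have hl0 : 0 ≤ l := le_trans (Real.log_nonneg (by norm_num)) hl2
  have h1 : Real.log (4 * (k : ℝ) / δ) ≤ 3 * l := by
    rw [mul_div_assoc, Real.log_mul (by norm_num) (by positivity),
      show (4 : ℝ) = 2 ^ 2 by norm_num, Real.log_pow]
    push_cast
    linarith
  have h0 : 0 ≤ Real.log (4 * (k : ℝ) / δ) := by
    refine Real.log_nonneg ?_
    rw [mul_div_assoc]
    linarith
  have hpow : (l ^ (5 / 2 : ℝ)) ^ 2 = l ^ 5 := by
    rw [← Real.rpow_natCast, ← Real.rpow_mul hl0, ← Real.rpow_natCast]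
    norm_num
  refine Real.sqrt_le_iff.2 ⟨by positivity, ?_⟩
  rw [mul_pow, mul_pow, Real.sq_sqrt (by positivity), hpow]
  have h2 := mul_le_mul_of_nonneg_left (pow_le_pow_left₀ h0 h1 5) (show (0 : ℝ) ≤ k by positivity)
  rw [mul_pow] at h2
  nlinarith [show 0 ≤ k * l ^ 5 by positivity]

end Main

theorem theorem3p2 :
    (∀ (k n : ℕ) (p : Fin k → ℝ) (δ : ℝ) (Ω : Type*) [MeasurableSpace Ω]
        (P : Measure Ω) [IsProbabilityMeasure P] (X : Fin n → Ω → Fin k),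
        0 < n → p ∈ stdSimplex ℝ (Fin k) → 0 < δ → δ ≤ 1 → IsIIDSample P p X →
        1 - δ ≤ P.real {ω | laplaceKL p X ω ≤ (∫ ω', laplaceKL p X ω' ∂P)
          + 6 * √((k : ℝ) * Real.log (4 * (k : ℝ) / δ) ^ 5) / (n : ℝ)
          + 311 / (n : ℝ) + 160 * (k : ℝ) / (n : ℝ) ^ (3 / 2 : ℝ)}) ∧
    (∃ C : ℝ, 0 < C ∧
      ∀ (k n : ℕ) (p : Fin k → ℝ) (δ : ℝ) (Ω : Type*) [MeasurableSpace Ω]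
        (P : Measure Ω) [IsProbabilityMeasure P] (X : Fin n → Ω → Fin k),
        k ≤ n → p ∈ stdSimplex ℝ (Fin k) → 0 < δ → δ ≤ 1 → IsIIDSample P p X →
        1 - δ ≤ P.real {ω | laplaceKL p X ω ≤ (∫ ω', laplaceKL p X ω' ∂P)
          + C * (√(k : ℝ) / (n : ℝ) * Real.log ((k : ℝ) / δ) ^ (5 / 2 : ℝ))}) := by
  constructor
  · intro k n p δ Ω _ P _ X hn hp hδ hδ1 hX
    refine (hX.laplaceKL_le hn hp hδ hδ1).trans (measureReal_mono fun ω hω => ?_)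
    simp only [Set.mem_ofPred_eq] at hω ⊢
    have h1 : (0 : ℝ) ≤ 311 / n := by positivity
    have h2 : (0 : ℝ) ≤ 160 * k / (n : ℝ) ^ (3 / 2 : ℝ) := by positivity
    linarith
  -- `96 = 6 * 16`, from the deviation bound and `sqrt_mul_log_pow_le`.
  · refine ⟨96, by norm_num, fun k n p δ Ω _ P _ X hkn hp hδ hδ1 hX => ?_⟩
    have hk0 : k ≠ 0 := by
      rintro rfl
      simpa using hp.2
    rcases (show k = 1 ∨ 2 ≤ k by omega) with hk | hk
    -- For `k = 1` and `δ = 1` the logarithm vanishes, so no constant could help; but the estimator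
    -- is then exact.
    · have hzero : ∀ ω, laplaceKL p X ω = 0 := fun ω =>
        discreteKL_laplaceEstimator_of_eq_one hp hk _
      have hlog : 0 ≤ Real.log ((k : ℝ) / δ) := by
        refine Real.log_nonneg ?_
        rw [hk, le_div_iff₀ hδ]
        simpa using hδ1
      have huniv : {ω | laplaceKL p X ω ≤ (∫ ω', laplaceKL p X ω' ∂P)
          + 96 * (√(k : ℝ) / (n : ℝ) * Real.log ((k : ℝ) / δ) ^ (5 / 2 : ℝ))} = Set.univ := by
        refine Set.eq_univ_of_forall fun ω => ?_
        simp only [hzero, integral_zero, Set.mem_ofPred_eq]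
        positivity
      rw [huniv, probReal_univ]
      linarith
    · have hn : 0 < n := by omega
      refine (hX.laplaceKL_le hn hp hδ hδ1).trans (measureReal_mono fun ω hω => ?_)
      simp only [Set.mem_ofPred_eq] at hω ⊢
      refine hω.trans (add_le_add_right ?_ _)
      rw [div_le_iff₀ (by positivity)]
      have h := sqrt_mul_log_pow_le hk hδ hδ1
      have h2 : 96 * (√(k : ℝ) / n * Real.log ((k : ℝ) / δ) ^ (5 / 2 : ℝ)) * n
          = 96 * (√(k : ℝ) * Real.log ((k : ℝ) / δ) ^ (5 / 2 : ℝ)) := by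
        field_simp
      rw [h2]
      linarith
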